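/- Let $G$ be an $n$-player normal-form game with finite action sets $\mathcal A_j$ and utility functions $u_j:\prod_k\mathcal A_k\to\mathbb R$, extended to profiles of (independently sampled) mixed strategies $s_j\in\Delta(\mathcal A_j)$ by expectation. Say that a strategy profile $s=s_{1:n}$ satisfies condition $(*)$ if some player $i$ has a strategy $s_i'\in\Delta(\mathcal A_i)$ with $$\min_{(s_j'\in\Delta(\mathcal A_j))_{j\neq i}}\ \sum_{j=1}^n\bigl(u_i(s_j',s_{-j})-u_i(s)\bigr)>0,$$ where the sum includes the term $j=i$ (with the fixed strategy $s_i'$), and $(s_j',s_{-j})$ is $s$ with player $j$'s strategy replaced by $s_j'$. In the uncorrelated program game of $G$, each player $i$ submits a program $p_i$; it receives the source codes $p_{-i}$ of the other programs (and its own) and a private sequence $(r^i_m)_{m\ge 0}$ of independent $U[0,1]$ variables, the sequences of different players being independent, and it outputs an action in $\mathcal A_i$; write $\mathit{apply}(p_i,(p_{-i},r))$ for its output. Programs are written in a Turing-complete language which can run other programs on inputs and sequences of its choice and can test in one step whether $r_m<c$, for $c$ a nonnegative rational or a member of a fixed, arbitrary sequence of real constants. A profile $(p_1,\dots,p_n)$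 is a program equilibrium if the programs almost surely halt against each other and each $p_i$ maximises player $i$'s expected utility against $p_{-i}$ among the programs for which the resulting profile almost surely halts. For $\epsilon>0$ and a policy $\pi_i$, an uncorrelated $\epsilon$Grounded$\pi_i$Bot is a program that, on input $(p_{-i},r)$, behaves as follows: let $T=\min\{t:r_t<\epsilon\}$; for $t=1,\dots,T$ and $j=1,\dots,n$ let $a_j^t=\mathit{apply}(p_j,(p_{-j},(r_m)_{m\ge T+1-t}))$; return $\pi_i(\bm a^{1:T};r_{0:T})$. An uncorrelated $\epsilon$Grounded$\pi$Bot equilibrium is a program equilibrium in which every $p_i$ is an uncorrelated $\epsilon_i$Grounded$\pi_i$Bot for some $\epsilon_i>0$ and some policy $\pi_i$. Let $v=v_{1:n}$ be a payoff vector. Then: 1. If $v=u_{1:n}(s)$ and $s$ satisfies $(*)$, then $v$ is not attained through $s$: there is no uncorrelated $\epsilon$Grounded$\pi$Bot equilibrium in which, for every $i$, the output of program $i$ is distributed according to $s_i$. 2. Consequently, if every strategy profile $s$ with $u_{1:n}(s)=v$ satisfies $(*)$ (in particular, if there is only one such $s$ and it satisfies $(*)$), then no uncorrelated $\epsilon$Grounded$\pi$Bot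 equilibrium has payoffs $v$. -/

import Mathlib

open MeasureTheory

namespace ProgramGame

/-! ### The programming language

Programs are codes for partial recursive functions on `ℕ` (the constructors `zero`, …, `rfind` are
those of `Nat.Partrec.Code`), with two further instructions.  `query` accesses the input sequence
of reals, and `run f g` is the `apply` call. -/

/-- Source codes of programs. -/
inductive Code : Type
  | zero : Code
  | succ : Code
  | left : Code
  | right : Code
  | pair : Code → Code → Code
  | comp : Code → Code → Code
  | prec : Code → Code → Code
  | rfind : Code → Code
  | query : Code
  | run : Code → Code → Code

/-- The source code as a number, which is how a program receives other programs (and itself). -/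
def Code.quote : Code → ℕ
  | .zero => Nat.pair 0 0
  | .succ => Nat.pair 1 0
  | .left => Nat.pair 2 0
  | .right => Nat.pair 3 0
  | .pair f g => Nat.pair 4 (Nat.pair f.quote g.quote)
  | .comp f g => Nat.pair 5 (Nat.pair f.quote g.quote)
  | .prec f g => Nat.pair 6 (Nat.pair f.quote g.quote)
  | .rfind f => Nat.pair 7 f.quote
  | .query => Nat.pair 8 0
  | .run f g => Nat.pair 9 (Nat.pair f.quote g.quote)

theorem Code.quote_injective : Function.Injective Code.quote := by
  intro c
  induction c with
  | zero | succ | left | right | query =>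
    intro d h; cases d <;> simp_all [Code.quote, Nat.pair_eq_pair]
  | pair f g hf hg | comp f g hf hg | prec f g hf hg | run f g hf hg =>
    intro d h
    cases d <;> simp [Code.quote, Nat.pair_eq_pair] at h
    rw [hf h.1, hg h.2]
  | rfind f hf =>
    intro d h
    cases d <;> simp [Code.quote, Nat.pair_eq_pair] at h
    rw [hf h]

/-- The partial inverse of `Code.quote`. -/
noncomputable def Code.unquote : ℕ → Option Code :=
  Function.partialInv Code.quote

/-- Evaluation with fuel.  `O` answers the queries about the input sequence.  In `run f g` on `v`,
the value of `f` at `v` is a pair (number of a program `c`, input list); the program `c` is run on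
that list, with its own source code supplied, and its queries `x` about its input sequence are
answered by the value of `g` at `(v, x)`. -/
noncomputable def Code.evalFuel : ℕ → (ℕ → Option ℕ) → Code → ℕ → Option ℕ
  | 0, _, _, _ => none
  | k + 1, O, c, v =>
    match c with
    | .zero => some 0
    | .succ => some (v + 1)
    | .left => some v.unpair.1
    | .right => some v.unpair.2
    | .pair f g =>
      (evalFuel k O f v).bind fun a => (evalFuel k O g v).bind fun b => some (Nat.pair a b)
    | .comp f g => (evalFuel k O g v).bind fun a => evalFuel k O f a
    | .prec f g =>
      match v.unpair.2 with
      | 0 => evalFuel k O f v.unpair.1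
      | y + 1 =>
        (evalFuel k O (.prec f g) (Nat.pair v.unpair.1 y)).bind fun a =>
          evalFuel k O g (Nat.pair v.unpair.1 (Nat.pair y a))
    | .rfind f =>
      (evalFuel k O f v).bind fun a =>
        if a = 0 then some v.unpair.2
        else evalFuel k O (.rfind f) (Nat.pair v.unpair.1 (v.unpair.2 + 1))
    | .query => O v
    | .run f g =>
      (evalFuel k O f v).bind fun a =>
        (Code.unquote a.unpair.1).bind fun d =>
          evalFuel k (fun x => evalFuel k O g (Nat.pair v x)) d a

/-- The thresholds to which a program can compare an entry of its input sequence: all rational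
numbers `a / (b + 1)`, and the members of a list `κ` of real constants. -/
noncomputable def threshold (κ : ℕ → ℝ) (e : ℕ) : ℝ :=
  if e.unpair.1 = 0 then (e.unpair.2.unpair.1 : ℝ) / ((e.unpair.2.unpair.2 : ℝ) + 1)
  else κ e.unpair.2

open Classical in
/-- The query `(m, e)` tests, in one step, whether `r m` is below the threshold number `e`. -/
noncomputable def seqOracle (κ : ℕ → ℝ) (r : ℕ → unitInterval) (x : ℕ) : Option ℕ :=
  some (if (r x.unpair.1 : ℝ) < threshold κ x.unpair.2 then 1 else 0)

/-! ### Program games without shared randomness -/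

section Game

variable {n : ℕ} {A : Fin n → Type*}

/-- The input of program `i` of the profile `p`: its own source code, paired with the list of the
source codes of the other programs. -/
def inputOf (p : Fin n → Code) (i : Fin n) : ℕ :=
  Nat.pair (p i).quote
    (Encodable.encode (((List.finRange n).filter (· ≠ i)).map fun j => (p j).quote))

/-- `apply (p i) (p_{-i}, r)` halts with output `a`. -/
def Outputs [∀ i, Encodable (A i)] (κ : ℕ → ℝ) (p : Fin n → Code) (i : Fin n)
    (r : ℕ → unitInterval) (a : A i) : Prop :=
  ∃ k, Code.evalFuel k (seqOracle κ r) (p i) (inputOf p i) = some (Encodable.encode a)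

/-- The law of an i.i.d. sequence of uniform random variables on `[0, 1]`. -/
noncomputable def uniformSeq : Measure (ℕ → unitInterval) :=
  Measure.infinitePi fun _ => (volume : Measure unitInterval)

/-- All programs of the profile halt (with an action as output) almost surely. -/
def HaltsAS [∀ i, Encodable (A i)] (κ : ℕ → ℝ) (p : Fin n → Code) : Prop :=
  ∀ i, ∀ᵐ r ∂uniformSeq, ∃ a : A i, Outputs κ p i r a

/-- The probability of the outcome `a`, when program `j` receives the sequence `ω j`, and these
sequences are independent. -/
noncomputable def outcomeProb [∀ i, Encodable (A i)] (κ : ℕ → ℝ) (p : Fin n → Code)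
    (a : ∀ i, A i) : ℝ :=
  (Measure.pi fun _ : Fin n => uniformSeq).real {ω | ∀ j, Outputs κ p j (ω j) (a j)}

/-- The expected utility of player `i` in the program game. -/
noncomputable def payoff [∀ i, Fintype (A i)] [∀ i, Encodable (A i)] (κ : ℕ → ℝ)
    (u : Fin n → (∀ j, A j) → ℝ) (p : Fin n → Code) (i : Fin n) : ℝ :=
  ∑ a : ∀ j, A j, outcomeProb κ p a * u i a

/-- The strategy that program `i` of the profile plays: the distribution of its output. -/
noncomputable def playedStrategy [∀ i, Encodable (A i)] (κ : ℕ → ℝ) (p : Fin n → Code)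
    (i : Fin n) (a : A i) : ℝ :=
  uniformSeq.real {r | Outputs κ p i r a}

/-- Program equilibrium: the programs halt against each other almost surely, and each is a best
response among the programs for which this remains so. -/
def IsProgramEquilibrium [∀ i, Fintype (A i)] [∀ i, Encodable (A i)] (κ : ℕ → ℝ)
    (u : Fin n → (∀ j, A j) → ℝ) (p : Fin n → Code) : Prop :=
  HaltsAS (A := A) κ p ∧
    ∀ (i : Fin n) (c : Code), HaltsAS (A := A) κ (Function.update p i c) →
      payoff κ u (Function.update p i c) i ≤ payoff κ u p i

/-- The code `c`, as a program of player `i`, is an uncorrelated `ε`-grounded `π`-bot: on any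
opponents and any sequence `r` it does what the following algorithm does.  Let `T` be the first
index with `r T < ε`; for `t = 1, …, T` (here `t - 1 : Fin T`) let `h (t - 1) j` be the output of
program `j` of the profile on the sequence `(r m)`, `m ≥ T + 1 - t`; return `π (h; r 0, …, r T)`.
The algorithm fails to halt if there is no such `T` or if one of these simulations fails to halt.
The policy `π` is computed by `c`, so its computability is not a separate requirement. -/
def IsGroundedBot [∀ i, Encodable (A i)] (κ : ℕ → ℝ) (i : Fin n) (ε : ℝ)
    (π : List (∀ j, A j) → List unitInterval → A i) (c : Code) : Prop :=
  ∀ (p : Fin n → Code), p i = c → ∀ (r : ℕ → unitInterval) (a : A i),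
    Outputs κ p i r a ↔
      ∃ T : ℕ, IsLeast {t | (r t : ℝ) < ε} T ∧
        ∃ h : Fin T → ∀ j, A j,
          (∀ (t : Fin T) (j : Fin n), Outputs κ p j (fun m => r (m + (T - t))) (h t j)) ∧
          a = π (List.ofFn h) (List.ofFn fun m : Fin (T + 1) => r m)

/-- A program equilibrium in which every program is an uncorrelated `ε`-grounded `π`-bot, for some
`ε > 0` and some policy `π` which may depend on the player. -/
def IsGroundedBotEquilibrium [∀ i, Fintype (A i)] [∀ i, Encodable (A i)] (κ : ℕ → ℝ)
    (u : Fin n → (∀ j, A j) → ℝ) (p : Fin n → Code) : Prop :=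
  IsProgramEquilibrium κ u p ∧
    ∀ i, ∃ ε : ℝ, 0 < ε ∧ ∃ π : List (∀ j, A j) → List unitInterval → A i,
      IsGroundedBot κ i ε π (p i)

/-! ### The normal-form game -/

/-- `s` is a profile of mixed strategies. -/
def IsStrategyProfile [∀ i, Fintype (A i)] (s : ∀ j, A j → ℝ) : Prop :=
  ∀ j, s j ∈ stdSimplex ℝ (A j)

/-- The expectation of `w` when the players independently follow the strategies `s`. -/
noncomputable def mixedUtility [∀ i, Fintype (A i)] (w : (∀ j, A j) → ℝ) (s : ∀ j, A j → ℝ) : ℝ :=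
  ∑ a : ∀ j, A j, w a * ∏ j, s j (a j)

/-- Some player `i` has a strategy `d` such that the minimum, over the strategies `s' j` of the
players `j ≠ i`, of `∑ j, (u i (s' j, s_{-j}) - u i s)` is positive, where `s' i = d`. -/
def HasRobustDeviation [∀ i, Fintype (A i)] (u : Fin n → (∀ j, A j) → ℝ)
    (s : ∀ j, A j → ℝ) : Prop :=
  ∃ (i : Fin n) (d : A i → ℝ), d ∈ stdSimplex ℝ (A i) ∧ ∃ μ : ℝ, 0 < μ ∧
    IsLeast {x : ℝ | ∃ s' : ∀ j, A j → ℝ, IsStrategyProfile s' ∧ s' i = d ∧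
      x = ∑ j, (mixedUtility (u i) (Function.update s j (s' j)) - mixedUtility (u i) s)} μ

end Game

end ProgramGame

/-! Suppose grounded bots `p` form an equilibrium whose played profile `s` admits a robust deviation
of player `i`. The other bots simulate `i`, so any deviation also alters their play; the point is to
make all these reactions happen on one controlled event. Every simulation made by a bot runs on a
suffix of that bot's own sequence. Fix `ε₀` below every `ε j` and let `T` be the first index with `r
T < ε₀`. A bot stops at an index at most `T`, so each suffix it passes on still has `r T` as its
first entry below `ε₀` (`isLeast_shift`). Let `i` play an action `a` when this entry lies in a small
interval, and copy `p i` otherwise. Then one event governs a program and all its nested simulations: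
off it, outputs are unchanged (`outputs_deviate_of_outputs`); on it, `i` plays `a` and the others
still halt (`exists_outputs_deviate`).

Let `δ` be the probability of the event. Every player's strategy moves by at most `δ`, and the
players' sequences are independent, so up to `o(δ)` the change in the utility of `i` is a sum over
`j` of changes in the strategy of `j` alone (`exists_abs_mixedUtility_sub_le`). Whatever the others
now play on the event, robustness makes the new terms at least `δ (μ + n u_i(s))`. The old play may
be correlated with the interval, but over a partition into intervals it adds up to `s`, so for some
interval of positive probability the old terms are at most `δ n u_i(s)` (`exists_pos_le_mul_sum`).
There the gain is at least `δ μ - o(δ)`, which is positive if the partition is fine. -/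

namespace ProgramGame

/-! ### Evaluation of codes -/

/-- Monotonicity in the oracle is needed along with that in the fuel, because `run` answers inner
queries by an evaluation that itself consumes fuel. -/
theorem Code.evalFuel_mono {k : ℕ} : ∀ {k' : ℕ} {O O' : ℕ → Option ℕ} {c : Code} {v a : ℕ},
    k ≤ k' → (∀ x b, O x = some b → O' x = some b) →
      Code.evalFuel k O c v = some a → Code.evalFuel k' O' c v = some a := by
  induction k with
  | zero => intro k' O O' c v a _ _ h; simp [Code.evalFuel] at h
  | succ k ih =>
    intro k' O O' c v a hk hO h
    obtain ⟨k', rfl⟩ : ∃ l, k' = l + 1 := ⟨k' - 1, by omega⟩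
    have hk : k ≤ k' := by omega
    cases c with
    | zero | succ | left | right => simpa [Code.evalFuel] using h
    | query => simp only [Code.evalFuel] at h ⊢; exact hO _ _ h
    | pair f g =>
      simp only [Code.evalFuel, Option.bind_eq_some_iff] at h ⊢
      obtain ⟨x, hx, y, hy, h⟩ := h
      exact ⟨x, ih hk hO hx, y, ih hk hO hy, h⟩
    | comp f g =>
      simp only [Code.evalFuel, Option.bind_eq_some_iff] at h ⊢
      obtain ⟨x, hx, h⟩ := h
      exact ⟨x, ih hk hO hx, ih hk hO h⟩
    | prec f g =>
      rcases hv : v.unpair.2 with _ | y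
      · simp only [Code.evalFuel, hv] at h ⊢
        exact ih hk hO h
      · simp only [Code.evalFuel, hv, Option.bind_eq_some_iff] at h ⊢
        obtain ⟨x, hx, h⟩ := h
        exact ⟨x, ih hk hO hx, ih hk hO h⟩
    | rfind f =>
      simp only [Code.evalFuel, Option.bind_eq_some_iff] at h ⊢
      obtain ⟨x, hx, h⟩ := h
      refine ⟨x, ih hk hO hx, ?_⟩
      split_ifs at h ⊢ with h0
      · exact h
      · exact ih hk hO h
    | run f g =>
      simp only [Code.evalFuel, Option.bind_eq_some_iff] at h ⊢
      obtain ⟨x, hx, d, hd, h⟩ := h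
      exact ⟨x, ih hk hO hx, d, hd, ih hk (fun _ _ => ih hk hO) h⟩

/-- The code `c` halts on the input `v` with output `a`. -/
def Code.Evaluates (O : ℕ → Option ℕ) (c : Code) (v a : ℕ) : Prop :=
  ∃ k, Code.evalFuel k O c v = some a

namespace Code

variable {O : ℕ → Option ℕ} {c f g t P : Code} {v a b x y : ℕ}

theorem Evaluates.unique (ha : Evaluates O c v a) (hb : Evaluates O c v b) : a = b := by
  obtain ⟨k, hk⟩ := ha
  obtain ⟨l, hl⟩ := hb
  have h₁ := evalFuel_mono (le_max_left k l) (fun _ _ h => h) hk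
  have h₂ := evalFuel_mono (le_max_right k l) (fun _ _ h => h) hl
  exact Option.some.inj (h₁.symm.trans h₂)

theorem evaluates_zero : Evaluates O .zero v 0 := ⟨1, by simp [evalFuel]⟩

theorem evaluates_succ : Evaluates O .succ v (v + 1) := ⟨1, by simp [evalFuel]⟩

theorem evaluates_left : Evaluates O .left v v.unpair.1 := ⟨1, by simp [evalFuel]⟩

theorem evaluates_right : Evaluates O .right v v.unpair.2 := ⟨1, by simp [evalFuel]⟩

theorem evaluates_query (h : O v = some a) : Evaluates O .query v a := ⟨1, by simpa [evalFuel]⟩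

theorem Evaluates.pair (hf : Evaluates O f v a) (hg : Evaluates O g v b) :
    Evaluates O (.pair f g) v (Nat.pair a b) := by
  obtain ⟨k, hk⟩ := hf
  obtain ⟨l, hl⟩ := hg
  refine ⟨max k l + 1, ?_⟩
  simp [evalFuel, evalFuel_mono (le_max_left k l) (fun _ _ h => h) hk,
    evalFuel_mono (le_max_right k l) (fun _ _ h => h) hl]

theorem Evaluates.comp (hg : Evaluates O g v a) (hf : Evaluates O f a b) :
    Evaluates O (.comp f g) v b := by
  obtain ⟨k, hk⟩ := hg
  obtain ⟨l, hl⟩ := hf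
  refine ⟨max k l + 1, ?_⟩
  simp [evalFuel, evalFuel_mono (le_max_left k l) (fun _ _ h => h) hk,
    evalFuel_mono (le_max_right k l) (fun _ _ h => h) hl]

theorem Evaluates.prec_zero (hf : Evaluates O f v a) :
    Evaluates O (.prec f g) (Nat.pair v 0) a := by
  obtain ⟨k, hk⟩ := hf
  exact ⟨k + 1, by simp [evalFuel, hk]⟩

theorem Evaluates.prec_succ (h : Evaluates O (.prec f g) (Nat.pair v y) a)
    (hg : Evaluates O g (Nat.pair v (Nat.pair y a)) b) :
    Evaluates O (.prec f g) (Nat.pair v (y + 1)) b := by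
  obtain ⟨k, hk⟩ := h
  obtain ⟨l, hl⟩ := hg
  refine ⟨max k l + 1, ?_⟩
  simp [evalFuel, evalFuel_mono (le_max_left k l) (fun _ _ h => h) hk,
    evalFuel_mono (le_max_right k l) (fun _ _ h => h) hl]

theorem Evaluates.rfind_zero (hf : Evaluates O f v 0) : Evaluates O (.rfind f) v v.unpair.2 := by
  obtain ⟨k, hk⟩ := hf
  exact ⟨k + 1, by simp [evalFuel, hk]⟩

theorem Evaluates.rfind_succ (hf : Evaluates O f (Nat.pair v x) (y + 1))
    (h : Evaluates O (.rfind f) (Nat.pair v (x + 1)) a) :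
    Evaluates O (.rfind f) (Nat.pair v x) a := by
  obtain ⟨k, hk⟩ := hf
  obtain ⟨l, hl⟩ := h
  refine ⟨max k l + 1, ?_⟩
  simp [evalFuel, evalFuel_mono (le_max_left k l) (fun _ _ h => h) hk,
    evalFuel_mono (le_max_right k l) (fun _ _ h => h) hl]

/-! ### Building blocks of programs -/

/-- A program for the constant function with value `x`. -/
def const : ℕ → Code
  | 0 => .zero
  | x + 1 => .comp .succ (const x)

theorem evaluates_const : ∀ x, Evaluates O (const x) v x
  | 0 => evaluates_zero
  | x + 1 => (evaluates_const x).comp evaluates_succ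

/-- A program that branches according to whether the value of `c` vanishes. -/
def ifz (c f g : Code) : Code :=
  .comp (.prec f (.comp g .left)) (.pair (.pair .left .right) c)

theorem evaluates_pair_left_right : Evaluates O (.pair .left .right) v v := by
  simpa using (evaluates_left (O := O) (v := v)).pair evaluates_right

theorem Evaluates.ifz_zero (hc : Evaluates O c v 0) (hf : Evaluates O f v a) :
    Evaluates O (ifz c f g) v a :=
  (evaluates_pair_left_right.pair hc).comp hf.prec_zero

/-- Primitive recursion computes its base case before the step, so `f` must halt even when `g`
supplies the answer. -/
theorem Evaluates.ifz_one (hc : Evaluates O c v 1) (hf : Evaluates O f v b)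
    (hg : Evaluates O g v a) : Evaluates O (ifz c f g) v a := by
  refine (evaluates_pair_left_right.pair hc).comp (hf.prec_zero.prec_succ (y := 0) ?_)
  exact evaluates_left.comp (by simpa using hg)

/-- A program that tests whether the entry of the input sequence with index computed by `t` is
below the threshold number `e`. -/
def testBelow (t : Code) (e : ℕ) : Code :=
  .comp .query (.pair t (const e))

/-- The negation of `testBelow`. -/
def testNotBelow (t : Code) (e : ℕ) : Code :=
  ifz (testBelow t e) (const 1) (const 0)

/-- A program that searches for the first entry below the threshold number `e`. -/
def firstBelow (e : ℕ) : Code :=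
  .comp (.rfind (testNotBelow .right e)) .zero

/-- A program that outputs `a` if the first entry of the input sequence below threshold number `e`
is between the thresholds number `lo` and `hi`, and otherwise behaves as `P`. -/
def branch (e lo hi a : ℕ) (P : Code) : Code :=
  ifz (testBelow (firstBelow e) lo) (ifz (testNotBelow (firstBelow e) hi) (const a) P) P

variable {κ : ℕ → ℝ} {r : ℕ → unitInterval} {e lo hi T : ℕ}

theorem evaluates_testBelow_one (ht : Evaluates (seqOracle κ r) t v T)
    (h : (r T : ℝ) < threshold κ e) : Evaluates (seqOracle κ r) (testBelow t e) v 1 :=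
  (ht.pair (evaluates_const e)).comp (evaluates_query (by simp [seqOracle, h]))

theorem evaluates_testBelow_zero (ht : Evaluates (seqOracle κ r) t v T)
    (h : ¬ (r T : ℝ) < threshold κ e) : Evaluates (seqOracle κ r) (testBelow t e) v 0 :=
  (ht.pair (evaluates_const e)).comp (evaluates_query (by simp [seqOracle, h]))

theorem evaluates_testNotBelow_zero (ht : Evaluates (seqOracle κ r) t v T)
    (h : (r T : ℝ) < threshold κ e) : Evaluates (seqOracle κ r) (testNotBelow t e) v 0 :=
  (evaluates_testBelow_one ht h).ifz_one (evaluates_const 1) (evaluates_const 0)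

theorem evaluates_testNotBelow_one (ht : Evaluates (seqOracle κ r) t v T)
    (h : ¬ (r T : ℝ) < threshold κ e) : Evaluates (seqOracle κ r) (testNotBelow t e) v 1 :=
  (evaluates_testBelow_zero ht h).ifz_zero (evaluates_const 1)

theorem evaluates_firstBelow (hT : IsLeast {t | (r t : ℝ) < threshold κ e} T) :
    Evaluates (seqOracle κ r) (firstBelow e) v T := by
  -- The search is followed backwards from `T`, over all its starting points `m`; the actual input
  -- `0` is `Nat.pair 0 0`.
  have key : ∀ m ≤ T, Evaluates (seqOracle κ r) (.rfind (testNotBelow .right e)) (Nat.pair 0 m) T := by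
    intro m hm
    induction hm using Nat.decreasingInduction with
    | self =>
      have h : Evaluates (seqOracle κ r) .right (Nat.pair 0 T) T := by
        simpa using evaluates_right (O := seqOracle κ r) (v := Nat.pair 0 T)
      simpa using (evaluates_testNotBelow_zero h hT.1).rfind_zero
    | of_succ m hm ih =>
      have h : Evaluates (seqOracle κ r) .right (Nat.pair 0 m) m := by
        simpa using evaluates_right (O := seqOracle κ r) (v := Nat.pair 0 m)
      exact (evaluates_testNotBelow_one h fun hlt => absurd (hT.2 hlt) (by omega)).rfind_succ ih
  exact evaluates_zero.comp (key 0 (Nat.zero_le _))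

/-- The upper test is negated so that both conditions vanish inside the cell; `P` is then never run
and need not halt. -/
theorem evaluates_branch_of_mem (hT : IsLeast {t | (r t : ℝ) < threshold κ e} T)
    (hlo : threshold κ lo ≤ r T) (hhi : (r T : ℝ) < threshold κ hi) :
    Evaluates (seqOracle κ r) (branch e lo hi a P) v a :=
  (evaluates_testBelow_zero (evaluates_firstBelow hT) hlo.not_gt).ifz_zero
    ((evaluates_testNotBelow_zero (evaluates_firstBelow hT) hhi).ifz_zero (evaluates_const a))

theorem evaluates_branch_of_notMem (hT : IsLeast {t | (r t : ℝ) < threshold κ e} T)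
    (h : ¬ (threshold κ lo ≤ r T ∧ (r T : ℝ) < threshold κ hi))
    (hP : Evaluates (seqOracle κ r) P v x) :
    Evaluates (seqOracle κ r) (branch e lo hi a P) v x := by
  have hfirst := evaluates_firstBelow (v := v) hT
  by_cases hlo : (r T : ℝ) < threshold κ lo
  · by_cases hhi : (r T : ℝ) < threshold κ hi
    · exact (evaluates_testBelow_one hfirst hlo).ifz_one
        ((evaluates_testNotBelow_zero hfirst hhi).ifz_zero (evaluates_const a)) hP
    · exact (evaluates_testBelow_one hfirst hlo).ifz_one
        ((evaluates_testNotBelow_one hfirst hhi).ifz_one (evaluates_const a) hP) hP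
  · have hhi : ¬ (r T : ℝ) < threshold κ hi := fun hhi => h ⟨not_lt.1 hlo, hhi⟩
    exact (evaluates_testBelow_zero hfirst hlo).ifz_zero
      ((evaluates_testNotBelow_one hfirst hhi).ifz_one (evaluates_const a) hP)

/-! ### Measurability -/

/-- Each `bind` gives a countable union over intermediate values. The oracle is an arbitrary
function of `ω` because `run` replaces it by another random one. -/
theorem measurableSet_evalFuel {Ω : Type*} [MeasurableSpace Ω] {k : ℕ} :
    ∀ {O : Ω → ℕ → Option ℕ} (c : Code) (v a : ℕ),
      (∀ x b, MeasurableSet {ω | O ω x = some b}) →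
        MeasurableSet {ω | evalFuel k (O ω) c v = some a} := by
  induction k with
  | zero => intro O c v a _; simp [evalFuel]
  | succ k ih =>
    intro O c v a hO
    have key : ∀ {F : Ω → Option ℕ} {G : Ω → ℕ → Option ℕ},
        (∀ b, MeasurableSet {ω | F ω = some b}) → (∀ b, MeasurableSet {ω | G ω b = some a}) →
          MeasurableSet {ω | (F ω).bind (G ω) = some a} := by
      intro F G hF hG
      simp only [Option.bind_eq_some_iff, Set.ofPred_exists]
      exact .iUnion fun b => (hF b).inter (hG b)
    cases c with
    | zero | succ | left | right => simp [evalFuel]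
    | query => simpa only [evalFuel] using hO v a
    | pair f g =>
      simp only [evalFuel]
      refine key (fun b => ih f v b hO) fun b => ?_
      simp only [Option.bind_eq_some_iff, Set.ofPred_exists]
      exact .iUnion fun b' => (ih g v b' hO).inter (.const _)
    | comp f g =>
      simp only [evalFuel]
      exact key (fun b => ih g v b hO) fun b => ih f b a hO
    | prec f g =>
      rcases hv : v.unpair.2 with _ | y
      · simp only [evalFuel, hv]
        exact ih f _ a hO
      · simp only [evalFuel, hv]
        exact key (fun b => ih _ _ b hO) fun b => ih g _ a hO
    | rfind f =>
      simp only [evalFuel]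
      refine key (fun b => ih f v b hO) fun b => ?_
      split_ifs
      · exact .const _
      · exact ih _ _ a hO
    | run f g =>
      simp only [evalFuel]
      refine key (fun b => ih f v b hO) fun b => ?_
      rcases unquote b.unpair.1 with _ | d
      · simp
      · exact ih d b a fun x b' => ih g _ b' hO

end Code

/-! ### The first entry below a threshold -/

instance : IsProbabilityMeasure uniformSeq := by
  unfold uniformSeq; infer_instance

/-- The event that the input sequence has an entry below `ε`, and that the first one lies in `D`. -/
def firstEntryIn (ε : ℝ) (D : Set ℝ) : Set (ℕ → unitInterval) :=
  {r | ∃ T, IsLeast {t | (r t : ℝ) < ε} T ∧ (r T : ℝ) ∈ D}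

theorem exists_isLeast_lt {ε : ℝ} {r : ℕ → unitInterval} (h : ∃ t, (r t : ℝ) < ε) :
    ∃ T, IsLeast {t | (r t : ℝ) < ε} T := by
  classical
  exact ⟨Nat.find h, Nat.find_spec h, fun t ht => Nat.find_min' h ht⟩

/-- The event that the entries before `T` are at least `ε` and that the entry `T` lies in `D`. -/
def firstEntryAt (ε : ℝ) (D : Set ℝ) (T : ℕ) : Set (ℕ → unitInterval) :=
  Set.pi (Finset.range (T + 1)) fun s =>
    if s = T then Subtype.val ⁻¹' D else {x | ε ≤ (x : ℝ)}

theorem measurableSet_ite_firstEntry {ε : ℝ} {D : Set ℝ} (hD : MeasurableSet D) (T s : ℕ) :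
    MeasurableSet (if s = T then Subtype.val ⁻¹' D else {x : unitInterval | ε ≤ (x : ℝ)}) := by
  split_ifs
  · exact measurable_subtype_coe hD
  · exact measurableSet_le measurable_const measurable_subtype_coe

theorem mem_firstEntryAt {ε : ℝ} {D : Set ℝ} {T : ℕ} {r : ℕ → unitInterval} :
    r ∈ firstEntryAt ε D T ↔ (∀ s < T, ε ≤ r s) ∧ (r T : ℝ) ∈ D := by
  simp only [firstEntryAt, Set.mem_pi, Finset.coe_range, Set.mem_Iio]
  constructor
  · refine fun h => ⟨fun s hs => ?_, by simpa using h T (by omega)⟩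
    simpa [hs.ne] using h s (by omega)
  · rintro ⟨h, hT⟩ s hs
    split_ifs with hsT
    · exact hsT ▸ hT
    · exact h s (by omega)

theorem firstEntryIn_eq_iUnion {ε : ℝ} {D : Set ℝ} :
    firstEntryIn ε D = ⋃ T, firstEntryAt ε (D ∩ Set.Iio ε) T := by
  ext r
  simp only [firstEntryIn, Set.mem_ofPred_eq, Set.mem_iUnion, mem_firstEntryAt]
  refine exists_congr fun T => ⟨fun ⟨hT, hD⟩ => ⟨fun s hs => ?_, hD, hT.1⟩,
    fun ⟨h, hD, hT⟩ => ⟨⟨hT, fun t ht => ?_⟩, hD⟩⟩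
  · by_contra! hlt
    exact absurd (hT.2 hlt) (by omega)
  · by_contra! hlt
    exact absurd ht (h t hlt).not_gt

theorem measurableSet_firstEntryIn {ε : ℝ} {D : Set ℝ} (hD : MeasurableSet D) :
    MeasurableSet (firstEntryIn ε D) := by
  rw [firstEntryIn_eq_iUnion]
  exact .iUnion fun T => .pi (Finset.countable_toSet _) fun s _ =>
    measurableSet_ite_firstEntry (hD.inter measurableSet_Iio) T s

theorem volume_setOf_le_coe {ε : ℝ} (h0 : 0 ≤ ε) (h1 : ε ≤ 1) :
    volume {x : unitInterval | ε ≤ (x : ℝ)} = ENNReal.ofReal (1 - ε) :=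
  unitInterval.volume_Ici ⟨ε, h0, h1⟩

theorem volume_preimage_coe_le (D : Set ℝ) :
    volume (Subtype.val ⁻¹' D : Set unitInterval) ≤ volume D := by
  rw [unitInterval.volume_apply]
  exact measure_mono (Set.image_preimage_subset _ _)

theorem uniformSeq_firstEntryAt_le {ε : ℝ} (h0 : 0 ≤ ε) (h1 : ε ≤ 1) {D : Set ℝ}
    (hD : MeasurableSet D) (T : ℕ) :
    uniformSeq (firstEntryAt ε D T) ≤ ENNReal.ofReal (1 - ε) ^ T * volume D := by
  rw [firstEntryAt, uniformSeq,
    Measure.infinitePi_pi _ fun s _ => measurableSet_ite_firstEntry hD T s,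
    Finset.prod_range_succ, if_pos rfl]
  refine mul_le_mul' (le_of_eq ?_) (volume_preimage_coe_le D)
  rw [Finset.prod_congr rfl fun s hs => by
    rw [if_neg (Finset.mem_range.1 hs).ne, volume_setOf_le_coe h0 h1]]
  simp

/-- The first small entry occurs at `T` and lies in `D` with probability at most `(1 - ε) ^ T` times
the length of `D`; the geometric series sums to `1 / ε`. -/
theorem uniformSeq_firstEntryIn_le {ε : ℝ} (h0 : 0 < ε) (h1 : ε ≤ 1) {D : Set ℝ}
    (hD : MeasurableSet D) :
    uniformSeq (firstEntryIn ε D) ≤ (ENNReal.ofReal ε)⁻¹ * volume D := by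
  rw [firstEntryIn_eq_iUnion]
  refine (measure_iUnion_le _).trans ((ENNReal.tsum_le_tsum fun T =>
    (uniformSeq_firstEntryAt_le h0.le h1 (hD.inter measurableSet_Iio) T).trans
      (mul_le_mul_right (measure_mono Set.inter_subset_left) _)).trans ?_)
  rw [ENNReal.tsum_mul_right, ENNReal.tsum_geometric, ← ENNReal.ofReal_one,
    ← ENNReal.ofReal_sub _ (by linarith), sub_sub_cancel]

theorem ae_exists_lt {ε : ℝ} (h0 : 0 < ε) : ∀ᵐ r ∂uniformSeq, ∃ t, (r t : ℝ) < ε := by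
  wlog h1 : ε ≤ 1 generalizing ε
  · filter_upwards [this one_pos le_rfl] with r ⟨t, ht⟩
    exact ⟨t, ht.trans (not_le.1 h1)⟩
  rw [ae_iff]
  have hle : ∀ T : ℕ, uniformSeq {r | ¬ ∃ t, (r t : ℝ) < ε} ≤ ENNReal.ofReal (1 - ε) ^ T := by
    intro T
    have hms : MeasurableSet {x : unitInterval | ε ≤ (x : ℝ)} :=
      measurableSet_le measurable_const measurable_subtype_coe
    calc uniformSeq {r | ¬ ∃ t, (r t : ℝ) < ε}
        ≤ uniformSeq (Set.pi (Finset.range T) fun _ => {x | ε ≤ (x : ℝ)}) := by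
          refine measure_mono fun r hr s _ => ?_
          simp only [Set.mem_ofPred_eq, not_exists, not_lt] at hr ⊢
          exact hr s
      _ = ENNReal.ofReal (1 - ε) ^ T := by
          rw [uniformSeq, Measure.infinitePi_pi _ fun _ _ => hms]
          simp [volume_setOf_le_coe h0.le h1]
  refine le_antisymm (ge_of_tendsto' (ENNReal.tendsto_pow_atTop_nhds_zero_of_lt_one ?_) hle) zero_le
  rw [← ENNReal.ofReal_one]
  exact (ENNReal.ofReal_lt_ofReal_iff one_pos).2 (by linarith)

/-- The event that the first entry below `ε` lies in cell `k` of the partition of `[0, 1)` into `M`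
intervals of equal length. -/
def firstEntryCell (ε : ℝ) (M k : ℕ) : Set (ℕ → unitInterval) :=
  firstEntryIn ε (Set.Ico ((k : ℝ) / M) ((k + 1 : ℕ) / M))

theorem measurableSet_firstEntryCell {ε : ℝ} {M k : ℕ} : MeasurableSet (firstEntryCell ε M k) :=
  measurableSet_firstEntryIn measurableSet_Ico

theorem uniformSeq_real_firstEntryCell_le {ε : ℝ} (h0 : 0 < ε) (h1 : ε ≤ 1) (M k : ℕ) :
    uniformSeq.real (firstEntryCell ε M k) ≤ 1 / (ε * M) := by
  have h := uniformSeq_firstEntryIn_le h0 h1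
    (measurableSet_Ico (a := (k : ℝ) / M) (b := ((k + 1 : ℕ) : ℝ) / M))
  rw [Real.volume_Ico, ← ENNReal.ofReal_inv_of_pos h0,
    ← ENNReal.ofReal_mul (inv_nonneg.2 h0.le)] at h
  refine (ENNReal.toReal_le_of_le_ofReal ?_ h).trans_eq ?_
  · rw [← sub_div, Nat.cast_succ, add_sub_cancel_left]
    positivity
  · rw [← sub_div, Nat.cast_succ, add_sub_cancel_left, one_div, one_div, mul_inv]

theorem pairwise_disjoint_firstEntryCell (ε : ℝ) (M : ℕ) :
    Pairwise (Function.onFun Disjoint fun k : Fin M => firstEntryCell ε M k) := by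
  have key : ∀ k l : Fin M, (k : ℕ) < l →
      Disjoint (firstEntryCell ε M k) (firstEntryCell ε M l) := by
    intro k l hkl
    refine Set.disjoint_left.2 ?_
    rintro r ⟨T, hT, hk⟩ ⟨T', hT', hl⟩
    rw [hT.unique hT'] at hk
    have : ((k + 1 : ℕ) : ℝ) / M ≤ (l : ℕ) / M := by gcongr; exact hkl
    exact absurd (hk.2.trans_le this) hl.1.not_gt
  intro k l hkl
  rcases lt_or_gt_of_ne (Fin.val_ne_of_ne hkl) with h | h
  · exact key k l h
  · exact (key l k h).symm

theorem exists_mem_firstEntryCell {ε : ℝ} (h1 : ε ≤ 1) {M : ℕ} (hM : 0 < M)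
    {r : ℕ → unitInterval} (h : ∃ t, (r t : ℝ) < ε) : ∃ k : Fin M, r ∈ firstEntryCell ε M k := by
  obtain ⟨T, hT⟩ := exists_isLeast_lt h
  have hM' : (0 : ℝ) < M := Nat.cast_pos.2 hM
  have hr0 : 0 ≤ (r T : ℝ) * M := mul_nonneg (r T).2.1 hM'.le
  have hr1 : (r T : ℝ) < 1 := hT.1.trans_le h1
  refine ⟨⟨⌊(r T : ℝ) * M⌋₊, (Nat.floor_lt hr0).2 (by nlinarith)⟩, T, hT, ?_, ?_⟩
  · rw [div_le_iff₀ hM']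
    exact Nat.floor_le hr0
  · rw [lt_div_iff₀ hM']
    exact_mod_cast Nat.lt_floor_add_one _

/-- Almost surely there is an entry below `ε ≤ 1`, so the disjoint cells cover the space up to a
null set. -/
theorem sum_uniformSeq_real_inter_firstEntryCell {ε : ℝ} (h0 : 0 < ε) (h1 : ε ≤ 1) {M : ℕ}
    (hM : 0 < M) {S : Set (ℕ → unitInterval)} (hS : MeasurableSet S) :
    ∑ k : Fin M, uniformSeq.real (S ∩ firstEntryCell ε M k) = uniformSeq.real S := by
  rw [← measureReal_iUnion_fintype
    (fun k l hkl => (pairwise_disjoint_firstEntryCell ε M hkl).mono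
      Set.inter_subset_right Set.inter_subset_right)
    fun k => hS.inter measurableSet_firstEntryCell]
  refine measureReal_congr ?_
  filter_upwards [ae_exists_lt h0] with r hr
  refine propext ⟨fun h => ?_, fun h => ?_⟩
  · obtain ⟨k, hk⟩ := Set.mem_iUnion.1 h
    exact hk.1
  · obtain ⟨k, hk⟩ := exists_mem_firstEntryCell h1 hM hr
    exact Set.mem_iUnion.2 ⟨k, h, hk⟩

/-! ### Expected utility as a function of the strategy profile -/

section Utility

variable {n : ℕ} {A : Fin n → Type*} [∀ i, Fintype (A i)]

theorem mixedUtility_update (w : (∀ j, A j) → ℝ) (s : ∀ j, A j → ℝ) (j : Fin n) (x : A j → ℝ) :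
    mixedUtility w (Function.update s j x) =
      ∑ a : ∀ j, A j, w a * (x (a j) * ∏ k ∈ Finset.univ.erase j, s k (a k)) := by
  refine Finset.sum_congr rfl fun a _ => ?_
  rw [← Finset.mul_prod_erase _ _ (Finset.mem_univ j), Function.update_self]
  congr 2
  exact Finset.prod_congr rfl fun k hk => by rw [Function.update_of_ne (Finset.ne_of_mem_erase hk)]

/-- The expected utility as a function of the strategy of player `j` alone. -/
noncomputable def utilityAgainst (w : (∀ j, A j) → ℝ) (s : ∀ j, A j → ℝ) (j : Fin n) :
    (A j → ℝ) →ₗ[ℝ] ℝ where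
  toFun x := mixedUtility w (Function.update s j x)
  map_add' x y := by
    simp only [mixedUtility_update, Pi.add_apply, add_mul, mul_add, Finset.sum_add_distrib]
  map_smul' c x := by
    simp only [mixedUtility_update, Pi.smul_apply, smul_eq_mul, RingHom.id_apply, Finset.mul_sum]
    exact Finset.sum_congr rfl fun a _ => by ring

theorem utilityAgainst_apply (w : (∀ j, A j) → ℝ) (s : ∀ j, A j → ℝ) (j : Fin n) (x : A j → ℝ) :
    utilityAgainst w s j x = mixedUtility w (Function.update s j x) := rfl

theorem utilityAgainst_self (w : (∀ j, A j) → ℝ) (s : ∀ j, A j → ℝ) (j : Fin n) :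
    utilityAgainst w s j (s j) = mixedUtility w s := by
  rw [utilityAgainst_apply, Function.update_eq_self]

theorem hasFDerivAt_mixedUtility (w : (∀ j, A j) → ℝ) (s : ∀ j, A j → ℝ) :
    HasFDerivAt (mixedUtility w)
      (∑ a : ∀ j, A j, w a • ∑ j, (∏ k ∈ Finset.univ.erase j, s k (a k)) •
        ((ContinuousLinearMap.proj (a j) : (A j → ℝ) →L[ℝ] ℝ).comp
          (ContinuousLinearMap.proj j : (∀ j, A j → ℝ) →L[ℝ] (A j → ℝ)))) s := by
  refine HasFDerivAt.fun_sum fun a _ => HasFDerivAt.const_mul ?_ (w a)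
  refine HasFDerivAt.finsetProd (g := fun j (s : ∀ j, A j → ℝ) => s j (a j)) fun j _ => ?_
  exact ((ContinuousLinearMap.proj (a j) : (A j → ℝ) →L[ℝ] ℝ).comp
    (ContinuousLinearMap.proj j : (∀ j, A j → ℝ) →L[ℝ] (A j → ℝ))).hasFDerivAt

/-- First-order expansion of the expected utility. -/
theorem exists_abs_mixedUtility_sub_le (w : (∀ j, A j) → ℝ) (s : ∀ j, A j → ℝ) {η : ℝ}
    (hη : 0 < η) :
    ∃ ρ : ℝ, 0 < ρ ∧ ∀ s' : ∀ j, A j → ℝ, ‖s' - s‖ ≤ ρ →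
      |mixedUtility w s' - mixedUtility w s - ∑ j, utilityAgainst w s j (s' j - s j)|
        ≤ η * ‖s' - s‖ := by
  have h := (hasFDerivAt_mixedUtility w s).isLittleO.def hη
  obtain ⟨ρ, hρ, h⟩ := Metric.nhds_basis_closedBall.eventually_iff.1 h
  refine ⟨ρ, hρ, fun s' hs' => ?_⟩
  have := h (mem_closedBall_iff_norm.2 hs')
  rw [Real.norm_eq_abs] at this
  convert this using 3
  simp only [utilityAgainst_apply, mixedUtility_update, sum_apply,
    smul_apply, ContinuousLinearMap.comp_apply,
    ContinuousLinearMap.proj_apply, smul_eq_mul, Pi.sub_apply, Finset.mul_sum]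
  rw [Finset.sum_comm]
  exact Finset.sum_congr rfl fun a _ => Finset.sum_congr rfl fun j _ => by ring

/-- A linear functional is bounded on a simplex by its value at some vertex. -/
theorem exists_le_apply_single {α : Type*} [Fintype α] [DecidableEq α] (f : (α → ℝ) →ₗ[ℝ] ℝ)
    {d : α → ℝ} (hd : d ∈ stdSimplex ℝ α) : ∃ a, f d ≤ f (Pi.single a 1) := by
  by_contra! h
  have hf : f d = ∑ a, d a * f (Pi.single a 1) := by
    conv_lhs => rw [pi_eq_sum_univ' d]
    simp [map_sum, map_smul]
  have hlt : ∑ a, d a * f (Pi.single a 1) < ∑ a, d a * f d := by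
    refine Finset.sum_lt_sum (fun a _ => mul_le_mul_of_nonneg_left (h a).le (hd.1 a)) ?_
    by_contra! h0
    have : ∀ a, d a = 0 := fun a => by
      have h1 := h0 a (Finset.mem_univ a)
      by_contra hne
      exact absurd (le_of_mul_le_mul_left h1 (lt_of_le_of_ne (hd.1 a) (Ne.symm hne))) (h a).not_ge
    simpa [this] using hd.2
  rw [← Finset.sum_mul, hd.2, one_mul, ← hf] at hlt
  exact hlt.false

/-- The deviation in `HasRobustDeviation` may be taken to be a single action. -/
theorem HasRobustDeviation.exists_action {u : Fin n → (∀ j, A j) → ℝ}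
    {s : ∀ j, A j → ℝ} [∀ i, DecidableEq (A i)]
    (h : HasRobustDeviation u s) :
    ∃ (i : Fin n) (a : A i) (μ : ℝ), 0 < μ ∧ ∀ s' : ∀ j, A j → ℝ, IsStrategyProfile s' →
      s' i = Pi.single a 1 → μ + n * mixedUtility (u i) s ≤ ∑ j, utilityAgainst (u i) s j (s' j) := by
  obtain ⟨i, d, hd, μ, hμ, hleast⟩ := h
  obtain ⟨a, ha⟩ := exists_le_apply_single (utilityAgainst (u i) s i) hd
  refine ⟨i, a, μ, hμ, fun s' hs' hs'i => ?_⟩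
  have hprofile : IsStrategyProfile (Function.update s' i d) := by
    intro j
    obtain rfl | hj := eq_or_ne j i
    · simpa using hd
    · simpa [hj] using hs' j
  have hle := hleast.2 ⟨Function.update s' i d, hprofile, Function.update_self .., rfl⟩
  simp only [← utilityAgainst_apply, Finset.sum_sub_distrib, Finset.sum_const, Finset.card_univ,
    Fintype.card_fin, nsmul_eq_mul] at hle
  -- The two sums differ only in the term `j = i`, where the vertex `a` does at least as well as
  -- `d`.
  have : ∑ j, utilityAgainst (u i) s j (Function.update s' i d j) ≤
      ∑ j, utilityAgainst (u i) s j (s' j) := by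
    refine Finset.sum_le_sum fun j _ => ?_
    obtain rfl | hj := eq_or_ne j i
    · simpa [hs'i] using ha
    · simp [hj]
  linarith

end Utility

/-! ### Outputs of programs -/

section Outputs

variable {n : ℕ} {A : Fin n → Type*} [∀ i, Encodable (A i)] {κ : ℕ → ℝ} {p : Fin n → Code}
  {i : Fin n}

theorem Outputs.unique {r : ℕ → unitInterval} {a b : A i} (ha : Outputs κ p i r a)
    (hb : Outputs κ p i r b) : a = b :=
  Encodable.encode_injective (Code.Evaluates.unique ha hb)

theorem measurableSet_outputs (a : A i) : MeasurableSet {r | Outputs κ p i r a} := by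
  unfold Outputs
  rw [Set.ofPred_exists]
  refine .iUnion fun k => Code.measurableSet_evalFuel _ _ _ fun x b => ?_
  have hlt : MeasurableSet {r : ℕ → unitInterval | (r x.unpair.1 : ℝ) < threshold κ x.unpair.2} :=
    measurableSet_lt (measurable_subtype_coe.comp (measurable_pi_apply _)) measurable_const
  simp only [seqOracle, Option.some.injEq]
  by_cases h1 : b = 1
  · convert hlt using 3
    simp [h1]
  · by_cases h0 : b = 0
    · convert hlt.compl using 1
      ext r
      simp [h0]
    · convert MeasurableSet.empty using 1
      ext r
      simp only [Set.mem_ofPred_eq, Set.mem_empty_iff_false, iff_false]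
      split_ifs
      · exact Ne.symm h1
      · exact Ne.symm h0

variable [∀ i, Fintype (A i)]

theorem sum_uniformSeq_real_outputs_inter (h : ∀ᵐ r ∂uniformSeq, ∃ a : A i, Outputs κ p i r a)
    {B : Set (ℕ → unitInterval)} (hB : MeasurableSet B) :
    ∑ a : A i, uniformSeq.real ({r | Outputs κ p i r a} ∩ B) = uniformSeq.real B := by
  rw [← measureReal_iUnion_fintype (fun a b hab => ?_)
    fun a => (measurableSet_outputs a).inter hB]
  · refine measureReal_congr ?_
    filter_upwards [h] with r ⟨a, ha⟩
    refine propext ⟨fun h => ?_, fun h => Set.mem_iUnion.2 ⟨a, ha, h⟩⟩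
    obtain ⟨b, hb⟩ := Set.mem_iUnion.1 h
    exact hb.2
  · exact Set.disjoint_left.2 fun r hra hrb => hab (Outputs.unique hra.1 hrb.1)

theorem HaltsAS.isStrategyProfile (h : HaltsAS (A := A) κ p) :
    IsStrategyProfile (playedStrategy (A := A) κ p) := fun i =>
  ⟨fun _ => measureReal_nonneg, by
    simpa [playedStrategy] using sum_uniformSeq_real_outputs_inter (h i) .univ⟩

/-- The sequences are independent, so each outcome event is a product set and only the marginal
output laws matter. -/
theorem payoff_eq_mixedUtility (u : Fin n → (∀ j, A j) → ℝ) (i : Fin n) :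
    payoff κ u p i = mixedUtility (u i) (playedStrategy κ p) := by
  refine Finset.sum_congr rfl fun a _ => ?_
  have : {ω : Fin n → ℕ → unitInterval | ∀ j, Outputs κ p j (ω j) (a j)} =
      Set.univ.pi fun j => {r | Outputs κ p j r (a j)} := by
    ext; simp
  rw [mul_comm, outcomeProb, this, Measure.real, Measure.pi_pi, ENNReal.toReal_prod]
  rfl

end Outputs

/-! ### The deviating program -/

section Deviation

variable {n : ℕ} {A : Fin n → Type*} [∀ i, Encodable (A i)] {κ : ℕ → ℝ} {p : Fin n → Code}
  {i : Fin n}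

/-- The number of the threshold `a / (b + 1)`. -/
def ratThreshold (a b : ℕ) : ℕ := Nat.pair 0 (Nat.pair a b)

theorem threshold_ratThreshold (a b : ℕ) :
    threshold κ (ratThreshold a b) = (a : ℝ) / (b + 1 : ℕ) := by
  simp [threshold, ratThreshold]

/-- The profile in which player `i` deviates to the following program: if the first entry below
`1 / (e + 1)` lies in `[k / (b + 1), (k + 1) / (b + 1))`, then play `a`, and otherwise play what
`p i` would play against the original profile. -/
def deviate (p : Fin n → Code) (i : Fin n) (a : A i) (e b k : ℕ) : Fin n → Code :=
  Function.update p i <|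
    Code.branch (ratThreshold 1 e) (ratThreshold k b) (ratThreshold (k + 1) b) (Encodable.encode a)
      (.comp (p i) (Code.const (inputOf p i)))

variable {a : A i} {e b k T : ℕ} {r : ℕ → unitInterval}

theorem outputs_deviate_of_mem (hT : IsLeast {t | (r t : ℝ) < (1 : ℕ) / (e + 1 : ℕ)} T)
    (hr : (r T : ℝ) ∈ Set.Ico ((k : ℝ) / (b + 1 : ℕ)) ((k + 1 : ℕ) / (b + 1 : ℕ))) :
    Outputs κ (deviate p i a e b k) i r a := by
  unfold Outputs
  rw [deviate, Function.update_self]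
  refine Code.evaluates_branch_of_mem (T := T) ?_ ?_ ?_
  · simpa only [threshold_ratThreshold] using hT
  · simpa only [threshold_ratThreshold] using hr.1
  · simpa only [threshold_ratThreshold] using hr.2

/-- The original input is hard-coded, so this is literally the original run of `p i`, simulations
included. -/
theorem outputs_deviate_of_notMem (hT : IsLeast {t | (r t : ℝ) < (1 : ℕ) / (e + 1 : ℕ)} T)
    (hr : (r T : ℝ) ∉ Set.Ico ((k : ℝ) / (b + 1 : ℕ)) ((k + 1 : ℕ) / (b + 1 : ℕ)))
    {x : A i} (hx : Outputs κ p i r x) :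
    Outputs κ (deviate p i a e b k) i r x := by
  unfold Outputs
  rw [deviate, Function.update_self]
  refine Code.evaluates_branch_of_notMem (T := T) ?_ ?_ ((Code.evaluates_const _).comp hx)
  · simpa only [threshold_ratThreshold] using hT
  · rw [threshold_ratThreshold, threshold_ratThreshold]
    exact hr

/-- The first small entry keeps its value under a shift that does not pass it, so caller and
simulated programs agree on its cell. -/
theorem isLeast_shift {ε : ℝ} (hT : IsLeast {t | (r t : ℝ) < ε} T) {m : ℕ} (hm : m ≤ T) :
    IsLeast {t | (r (t + m) : ℝ) < ε} (T - m) := by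
  refine ⟨?_, fun t ht => ?_⟩
  · simpa [Nat.sub_add_cancel hm] using hT.1
  · have := hT.2 (show t + m ∈ {t | (r t : ℝ) < ε} from ht)
    omega

variable {ε : Fin n → ℝ} {π : ∀ i, List (∀ j, A j) → List unitInterval → A i}

/-- Where the deviating program copies the original one, so do the grounded bots that simulate
it. -/
theorem outputs_deviate_of_outputs (hε : ∀ j, (1 : ℕ) / (e + 1 : ℕ) ≤ ε j)
    (hbot : ∀ j, IsGroundedBot κ j (ε j) (π j) (p j))
    (hT : IsLeast {t | (r t : ℝ) < (1 : ℕ) / (e + 1 : ℕ)} T)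
    (hr : (r T : ℝ) ∉ Set.Ico ((k : ℝ) / (b + 1 : ℕ)) ((k + 1 : ℕ) / (b + 1 : ℕ)))
    (j : Fin n) {x : A j} (hx : Outputs κ p j r x) :
    Outputs κ (deviate p i a e b k) j r x := by
  induction T using Nat.strong_induction_on generalizing r j with
  | _ T ih =>
    obtain rfl | hj := eq_or_ne j i
    · exact outputs_deviate_of_notMem hT hr hx
    · obtain ⟨S, hS, h, hh, rfl⟩ := (hbot j p rfl r x).1 hx
      refine (hbot j _ (Function.update_of_ne hj _ _) r _).2 ⟨S, hS, h, fun t l => ?_, rfl⟩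
      -- The shifts `S - t` lie between `1` and `S ≤ T`: the entry `r T` survives, and its index
      -- strictly drops, which drives the induction.
      have hST : S ≤ T := hS.2 (lt_of_lt_of_le hT.1 (hε j))
      have ht := t.2
      refine ih (T - (S - t)) (by omega) (isLeast_shift hT (by omega)) ?_ l (hh t l)
      rwa [Nat.sub_add_cancel (by omega)]

/-- Where the deviating program plays a fixed action, the grounded bots that simulate it halt. -/
theorem exists_outputs_deviate (hε : ∀ j, (1 : ℕ) / (e + 1 : ℕ) ≤ ε j)
    (hbot : ∀ j, IsGroundedBot κ j (ε j) (π j) (p j))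
    (hT : IsLeast {t | (r t : ℝ) < (1 : ℕ) / (e + 1 : ℕ)} T)
    (hr : (r T : ℝ) ∈ Set.Ico ((k : ℝ) / (b + 1 : ℕ)) ((k + 1 : ℕ) / (b + 1 : ℕ)))
    (j : Fin n) : ∃ x : A j, Outputs κ (deviate p i a e b k) j r x := by
  induction T using Nat.strong_induction_on generalizing r j with
  | _ T ih =>
    obtain rfl | hj := eq_or_ne j i
    · exact ⟨a, outputs_deviate_of_mem hT hr⟩
    -- The entry `r T` is below `ε j`, so the bot has a stopping index `S`; if `S = 0` it simulates
    -- nothing.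
    · obtain ⟨S, hS⟩ := exists_isLeast_lt (ε := ε j) ⟨T, lt_of_lt_of_le hT.1 (hε j)⟩
      have hST : S ≤ T := hS.2 (lt_of_lt_of_le hT.1 (hε j))
      have hsim : ∀ (t : Fin S) (l : Fin n), ∃ x : A l,
          Outputs κ (deviate p i a e b k) l (fun m => r (m + (S - t))) x := fun t l => by
        have ht := t.2
        refine ih (T - (S - t)) (by omega) (isLeast_shift hT (by omega)) ?_ l
        rwa [Nat.sub_add_cancel (by omega)]
      choose h hh using hsim
      exact ⟨_, (hbot j _ (Function.update_of_ne hj _ _) r _).2 ⟨S, hS, h, hh, rfl⟩⟩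

/-- This makes the deviation admissible in the best-response condition. -/
theorem haltsAS_deviate (hp : HaltsAS (A := A) κ p) (hε : ∀ j, (1 : ℕ) / (e + 1 : ℕ) ≤ ε j)
    (hbot : ∀ j, IsGroundedBot κ j (ε j) (π j) (p j)) :
    HaltsAS (A := A) κ (deviate p i a e b k) := by
  intro j
  filter_upwards [hp j, ae_exists_lt (ε := (1 : ℕ) / (e + 1 : ℕ)) (by positivity)]
    with r ⟨x, hx⟩ hlt
  obtain ⟨T, hT⟩ := exists_isLeast_lt hlt
  by_cases hr : (r T : ℝ) ∈ Set.Ico ((k : ℝ) / (b + 1 : ℕ)) ((k + 1 : ℕ) / (b + 1 : ℕ))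
  · exact exists_outputs_deviate hε hbot hT hr j
  · exact ⟨x, outputs_deviate_of_outputs hε hbot hT hr j hx⟩

theorem uniformSeq_real_outputs_deviate_diff (hp : HaltsAS (A := A) κ p)
    (hε : ∀ j, (1 : ℕ) / (e + 1 : ℕ) ≤ ε j) (hbot : ∀ j, IsGroundedBot κ j (ε j) (π j) (p j))
    (j : Fin n) (x : A j) :
    uniformSeq.real ({r | Outputs κ (deviate p i a e b k) j r x} \
        firstEntryCell ((1 : ℕ) / (e + 1 : ℕ)) (b + 1) k) =
      uniformSeq.real ({r | Outputs κ p j r x} \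
        firstEntryCell ((1 : ℕ) / (e + 1 : ℕ)) (b + 1) k) := by
  refine measureReal_congr ?_
  filter_upwards [hp j, ae_exists_lt (ε := (1 : ℕ) / (e + 1 : ℕ)) (by positivity)]
    with r ⟨y, hy⟩ hlt
  obtain ⟨T, hT⟩ := exists_isLeast_lt hlt
  refine propext (and_congr_left fun hr => ?_)
  have hmem : ∀ z : A j, Outputs κ p j r z → Outputs κ (deviate p i a e b k) j r z := fun z hz =>
    outputs_deviate_of_outputs hε hbot hT (fun hD => hr ⟨T, hT, hD⟩) j hz
  refine ⟨fun hx => ?_, hmem x⟩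
  -- The original output `y` persists after the deviation, and outputs are unique.
  have hxy : x = y := Outputs.unique hx (hmem y hy)
  exact hxy ▸ hy

end Deviation

/-! ### The main argument -/

section Main

variable {n : ℕ} {A : Fin n → Type*} [∀ i, Fintype (A i)] [∀ i, Encodable (A i)] {κ : ℕ → ℝ}
  {u : Fin n → (∀ j, A j) → ℝ} {p : Fin n → Code}

theorem exists_forall_one_div_le {ε : Fin n → ℝ} (hε : ∀ j, 0 < ε j) :
    ∃ e : ℕ, ∀ j, ((1 : ℕ) : ℝ) / (e + 1 : ℕ) ≤ ε j := by
  have h : ∀ j, ∀ᶠ e : ℕ in Filter.atTop, ((1 : ℕ) : ℝ) / (e + 1 : ℕ) ≤ ε j := fun j => by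
    simpa using (tendsto_one_div_add_atTop_nhds_zero_nat (𝕜 := ℝ)).eventually_le_const (hε j)
  exact (Filter.eventually_all.2 h).exists

/-- If the weights `δ` sum to `1` and `φ` vanishes where `δ` does, then `φ` is at most proportional
to `δ` somewhere. -/
theorem exists_pos_le_mul_sum {ι : Type*} [Fintype ι] {δ φ : ι → ℝ} (hδ : ∀ k, 0 ≤ δ k)
    (hsum : ∑ k, δ k = 1) (hφ : ∀ k, δ k = 0 → φ k = 0) :
    ∃ k, 0 < δ k ∧ φ k ≤ δ k * ∑ l, φ l := by
  by_contra! h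
  obtain ⟨k, -, hk⟩ : ∃ k ∈ Finset.univ, 0 < δ k :=
    Finset.exists_lt_of_sum_lt (f := fun _ => (0 : ℝ)) (by simp [hsum])
  have hlt : ∑ k, δ k * ∑ l, φ l < ∑ k, φ k := by
    refine Finset.sum_lt_sum (fun l _ => ?_) ⟨k, Finset.mem_univ k, h k hk⟩
    rcases (hδ l).eq_or_lt with h0 | h0
    · rw [← h0, hφ l h0.symm, zero_mul]
    · exact (h l h0).le
  rw [← Finset.sum_mul, hsum, one_mul] at hlt
  exact hlt.false

theorem IsGroundedBotEquilibrium.not_hasRobustDeviation (h : IsGroundedBotEquilibrium κ u p) :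
    ¬ HasRobustDeviation u (playedStrategy κ p) := by
  classical
  intro hdev
  obtain ⟨i, a, μ, hμ, hdev⟩ := hdev.exists_action
  obtain ⟨⟨hp, hbest⟩, hbot⟩ := h
  choose ε hε π hbot using hbot
  obtain ⟨e, he⟩ := exists_forall_one_div_le hε
  set s : ∀ j, A j → ℝ := playedStrategy κ p with hs
  set ε₀ : ℝ := (1 : ℕ) / (e + 1 : ℕ) with hε₀
  have hε₀0 : 0 < ε₀ := by positivity
  have hε₀1 : ε₀ ≤ 1 := by
    rw [hε₀, div_le_one (by positivity)]
    exact_mod_cast Nat.le_add_left 1 e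
  -- Half of the margin `μ` is reserved for the first-order error.
  obtain ⟨ρ, hρ, hexp⟩ := exists_abs_mixedUtility_sub_le (u i) s (half_pos hμ)
  -- A cell has probability at most `1 / (ε₀ (b + 1))`, hence at most `ρ`.
  obtain ⟨b, hb⟩ := exists_nat_one_div_lt (mul_pos hε₀0 hρ)
  let δ : Fin (b + 1) → ℝ := fun k => uniformSeq.real (firstEntryCell ε₀ (b + 1) k)
  let ν : Fin (b + 1) → ∀ j, A j → ℝ := fun k j x =>
    uniformSeq.real ({r | Outputs κ p j r x} ∩ firstEntryCell ε₀ (b + 1) k)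
  have hν : ∀ j, ∑ k, ν k j = s j := fun j => by
    ext x
    rw [Finset.sum_apply]
    exact sum_uniformSeq_real_inter_firstEntryCell hε₀0 hε₀1 b.succ_pos (measurableSet_outputs x)
  have hδsum : ∑ k, δ k = 1 := by
    simpa using sum_uniformSeq_real_inter_firstEntryCell hε₀0 hε₀1 b.succ_pos .univ
  have hνle : ∀ k j x, ν k j x ≤ δ k := fun k j x => measureReal_mono Set.inter_subset_right
  have hφsum : ∑ k, ∑ j, utilityAgainst (u i) s j (ν k j) = n * mixedUtility (u i) s := by
    rw [Finset.sum_comm]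
    simp [← map_sum, hν, utilityAgainst_self]
  -- The cell is chosen from the original play `ν` alone, before the deviation is formed. Cells of
  -- probability zero, such as those above `ε₀`, carry no part of `ν`.
  obtain ⟨k, hδk, hφk⟩ := exists_pos_le_mul_sum (φ := fun k => ∑ j, utilityAgainst (u i) s j (ν k j))
    (fun k => measureReal_nonneg) hδsum fun k hk => Finset.sum_eq_zero fun j _ => by
      rw [show ν k j = 0 from funext fun x => le_antisymm ((hνle k j x).trans_eq hk)
        measureReal_nonneg, map_zero]
  rw [hφsum] at hφk
  have hδρ : δ k ≤ ρ := by
    refine (uniformSeq_real_firstEntryCell_le hε₀0 hε₀1 (b + 1) k).trans ?_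
    rw [div_le_iff₀ (by positivity)]
    rw [div_lt_iff₀ (by positivity)] at hb
    push_cast
    nlinarith
  set p' := deviate p i a e b k with hp'
  have hhalts : HaltsAS (A := A) κ p' := haltsAS_deviate hp he hbot
  set s' : ∀ j, A j → ℝ := playedStrategy κ p' with hs'
  let w : ∀ j, A j → ℝ := fun j x =>
    uniformSeq.real ({r | Outputs κ p' j r x} ∩ firstEntryCell ε₀ (b + 1) k)
  have hwle : ∀ j x, w j x ≤ δ k := fun j x => measureReal_mono Set.inter_subset_right
  -- Off the cell the two output laws coincide, so only the parts on the cell remain.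
  have hdiff : ∀ j, s' j - s j = w j - ν k j := fun j => by
    ext x
    have h₁ := measureReal_inter_add_sdiff (μ := uniformSeq) (s := {r | Outputs κ p' j r x})
      (measurableSet_firstEntryCell (ε := ε₀) (M := b + 1) (k := k))
    have h₂ := measureReal_inter_add_sdiff (μ := uniformSeq) (s := {r | Outputs κ p j r x})
      (measurableSet_firstEntryCell (ε := ε₀) (M := b + 1) (k := k))
    rw [uniformSeq_real_outputs_deviate_diff hp he hbot, ← hε₀] at h₁
    simp only [Pi.sub_apply, hs', hs, playedStrategy, w, ν]
    linarith
  have hnorm : ‖s' - s‖ ≤ δ k := by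
    refine (pi_norm_le_iff_of_nonneg hδk.le).2 fun j =>
      (pi_norm_le_iff_of_nonneg hδk.le).2 fun x => ?_
    rw [Pi.sub_apply, hdiff, Pi.sub_apply, Real.norm_eq_abs]
    exact abs_sub_le_of_nonneg_of_le measureReal_nonneg (hwle j x) measureReal_nonneg (hνle k j x)
  -- These are the strategies conditional on the cell, to which the robust deviation applies.
  have hx : IsStrategyProfile fun j => (δ k)⁻¹ • w j := fun j =>
    ⟨fun x => mul_nonneg (inv_nonneg.2 hδk.le) measureReal_nonneg, by
      simp only [Pi.smul_apply, smul_eq_mul, ← Finset.mul_sum]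
      rw [sum_uniformSeq_real_outputs_inter (hhalts j) measurableSet_firstEntryCell]
      exact inv_mul_cancel₀ hδk.ne'⟩
  have hout : ∀ r ∈ firstEntryCell ε₀ (b + 1) k, Outputs κ p' i r a := by
    rintro r ⟨T, hT, hr⟩
    exact outputs_deviate_of_mem hT hr
  have hxi : (δ k)⁻¹ • w i = Pi.single a 1 := by
    ext x
    obtain rfl | hxa := eq_or_ne x a
    · have : w i x = δ k := congrArg uniformSeq.real (Set.inter_eq_right.2 hout)
      simpa [this] using inv_mul_cancel₀ hδk.ne'
    · have : w i x = 0 := by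
        have : {r | Outputs κ p' i r x} ∩ firstEntryCell ε₀ (b + 1) k = ∅ :=
          Set.eq_empty_of_forall_notMem fun r hr => hxa (Outputs.unique hr.1 (hout r hr.2))
        simp only [w, this, measureReal_empty]
      simp [this, hxa]
  have hgain := hdev _ hx hxi
  simp only [map_smul, smul_eq_mul, ← Finset.mul_sum] at hgain
  rw [← div_eq_inv_mul, le_div_iff₀ hδk] at hgain
  have hfirst := (abs_le.1 (hexp s' (hnorm.trans hδρ))).1
  simp only [hdiff, map_sub, Finset.sum_sub_distrib] at hfirst
  have hle := hbest i _ hhalts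
  change payoff κ u p' i ≤ _ at hle
  rw [payoff_eq_mixedUtility, payoff_eq_mixedUtility] at hle
  -- The gain is at least `δ k * μ - μ / 2 * ‖s' - s‖ ≥ δ k * μ / 2 > 0`, against `hle`.
  nlinarith [mul_pos hδk hμ, mul_le_mul_of_nonneg_left hnorm hμ.le]

end Main

end ProgramGame

theorem mainTheorem11 {n : ℕ} {A : Fin n → Type*} [∀ i, Fintype (A i)] [∀ i, Encodable (A i)]
    (κ : ℕ → ℝ) (u : Fin n → (∀ j, A j) → ℝ) (v : Fin n → ℝ) :
    (∀ s : ∀ j, A j → ℝ, ProgramGame.IsStrategyProfile s →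
      (∀ i, v i = ProgramGame.mixedUtility (u i) s) →
      ProgramGame.HasRobustDeviation u s →
      ¬ ∃ p : Fin n → ProgramGame.Code,
        ProgramGame.IsGroundedBotEquilibrium κ u p ∧
        ∀ i, ProgramGame.playedStrategy κ p i = s i) ∧
    ((∀ s : ∀ j, A j → ℝ, ProgramGame.IsStrategyProfile s →
        (∀ i, v i = ProgramGame.mixedUtility (u i) s) →
        ProgramGame.HasRobustDeviation u s) →
      ¬ ∃ p : Fin n → ProgramGame.Code,
        ProgramGame.IsGroundedBotEquilibrium κ u p ∧
        ∀ i, ProgramGame.payoff κ u p i = v i) := by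
  refine ⟨?_, ?_⟩
  · rintro s - - hdev ⟨p, hp, hs⟩
    obtain rfl : ProgramGame.playedStrategy κ p = s := funext hs
    exact hp.not_hasRobustDeviation hdev
  · rintro hdev ⟨p, hp, hv⟩
    -- The played profile is itself one of the profiles with payoffs `v`.
    exact hp.not_hasRobustDeviation (hdev _ hp.1.1.isStrategyProfile fun i => by
      rw [← hv, ProgramGame.payoff_eq_mixedUtility])
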